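/- Let $X$ be a finite alphabet, $\varepsilon$ the empty word, $\#$ a symbol not in $X$, and let $v^{\mathrm{rev}}$ denote the reverse of a word $v$. For a binary relation $\rho\subseteq X^*\times X^*$ put $$L_\rho=\{u\#v^{\mathrm{rev}} : (u,v)\in\rho\}\subseteq (X\cup\{\#\})^*.$$ Let $X_\varepsilon^2=(X\cup\{\varepsilon\})\times(X\cup\{\varepsilon\})$, regarded as an alphabet, and let $\pi$ map a word $(x_1,y_1)\cdots(x_k,y_k)$ over $X_\varepsilon^2$ to the pair $(x_1\cdots x_k,\;y_1\cdots y_k)\in X^*\times X^*$. For a class $\mathfrak C$ of languages, let $U(\mathfrak C)$ be the class of relations $\rho$ with $L_\rho\in\mathfrak C$, and let $T(\mathfrak C)$ be the class of relations $\rho$ such that $\rho=L\pi$ for some language $L\in\mathfrak C$ over $X_\varepsilon^2$. Let $\mathfrak C$ be the class of indexed, linear indexed, ET0L, EDT0L, context-free or rational languages, where a linear indexed grammar is one in which, at each derivation step, flags are copied to at most one of the (possibly several) non-terminals on the right-hand side of the production. Then $U(\mathfrak C)\subseteq T(\mathfrak C)$. -/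

import Mathlib

universe u

namespace WordRel

/-! ### Indexed and linear indexed grammars -/

/-- An occurrence of a non-terminal on the right-hand side of a production of a grammar with flags.
It carries the flags `push` that the production attaches to it (top of the stack first), and a mark
saying whether this occurrence receives a copy of the flags of the rewritten non-terminal. -/
structure FlagOccurrence (N F : Type) where
  nt : N
  push : List F
  inherits : Bool

/-- A production `A → α` (`pop = none`) or `A^f → α` (`pop = some f`). -/
structure FlagRule (T : Type u) (N F : Type) where
  input : N
  pop : Option F
  output : List (Symbol T (FlagOccurrence N F))

/-- A grammar with flags: finite sets of non-terminals and flags, a start symbol and a finite set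
of productions. The alphabet of terminals is `T`. -/
structure FlagGrammar (T : Type u) where
  NT : Type
  Flag : Type
  finite_NT : Finite NT
  finite_Flag : Finite Flag
  initial : NT
  rules : Set (FlagRule T NT Flag)
  finite_rules : rules.Finite

/-- Replace an occurrence `B` on a right-hand side by the non-terminal with its stack of flags,
when the remaining stack of the rewritten non-terminal is `s`. -/
def FlagOccurrence.toSymbol {T : Type u} {N F : Type} (s : List F) :
    Symbol T (FlagOccurrence N F) → Symbol T (N × List F)
  | .terminal a => .terminal a
  | .nonterminal B => .nonterminal (B.nt, B.push ++ if B.inherits then s else [])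

namespace FlagGrammar

variable {T : Type u}

/-- One derivation step. Sentential forms consist of terminals and of non-terminals carrying a stack
of flags. A production `A^f → α` applies to `A` when `f` is on top of its stack, and removes it. -/
def Produces (g : FlagGrammar T) (w w' : List (Symbol T (g.NT × List g.Flag))) : Prop :=
  ∃ r ∈ g.rules, ∃ (s : List g.Flag) (p q : List (Symbol T (g.NT × List g.Flag))),
    w = p ++ [Symbol.nonterminal (r.input, r.pop.toList ++ s)] ++ q ∧
    w' = p ++ r.output.map (FlagOccurrence.toSymbol s) ++ q

/-- The generated language; derivations begin with the start symbol without flags. -/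
def language (g : FlagGrammar T) : Language T :=
  {w | Relation.ReflTransGen g.Produces [Symbol.nonterminal (g.initial, [])]
    (w.map Symbol.terminal)}

/-- The grammar is an indexed grammar: flags are copied to all non-terminals on the right. -/
def IsIndexed (g : FlagGrammar T) : Prop :=
  ∀ r ∈ g.rules, ∀ B : FlagOccurrence g.NT g.Flag,
    Symbol.nonterminal B ∈ r.output → B.inherits = true

/-- Whether a symbol of a right-hand side is a non-terminal that receives a copy of the flags. -/
def inheritsFlags {N F : Type} : Symbol T (FlagOccurrence N F) → Bool
  | .terminal _ => false
  | .nonterminal B => B.inherits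

/-- The grammar is a linear indexed grammar: a production may have several non-terminals on the
right, but flags are copied to at most one of them. -/
def IsLinearIndexed (g : FlagGrammar T) : Prop :=
  ∀ r ∈ g.rules, r.output.countP inheritsFlags ≤ 1

end FlagGrammar

/-! ### ET0L and EDT0L systems -/

/-- An ET0L-system with terminal alphabet `T`. Its full alphabet `V` is the disjoint union
`Symbol T NT` of `T` and a finite set `NT`. A table is a finite subset of `V × V*` that contains at
least one production for every letter of `V`, including the terminals. -/
structure ET0LSystem (T : Type u) where
  NT : Type
  finite_NT : Finite NT
  start : List (Symbol T NT)
  tables : Set (Set (Symbol T NT × List (Symbol T NT)))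
  finite_tables : tables.Finite
  finite_table : ∀ t ∈ tables, t.Finite
  total_table : ∀ t ∈ tables, ∀ a, ∃ x, (a, x) ∈ t

namespace ET0LSystem

variable {T : Type u}

/-- One derivation step: choose a table and rewrite all letters in parallel by productions from it,
where different occurrences of a letter may be rewritten differently. -/
def Produces (h : ET0LSystem T) (w w' : List (Symbol T h.NT)) : Prop :=
  ∃ t ∈ h.tables, ∃ xs : List (List (Symbol T h.NT)),
    List.Forall₂ (fun a x => (a, x) ∈ t) w xs ∧ w' = xs.flatten

/-- The generated language: the words over `T` derivable from the start word. -/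
def language (h : ET0LSystem T) : Language T :=
  {w | Relation.ReflTransGen h.Produces h.start (w.map Symbol.terminal)}

/-- The system is deterministic (an EDT0L-system): each table has exactly one production for every
letter. -/
def IsDeterministic (h : ET0LSystem T) : Prop :=
  ∀ t ∈ h.tables, ∀ a, ∃! x, (a, x) ∈ t

end ET0LSystem

/-! ### The language classes -/

/-- A class of languages, over arbitrary alphabets. -/
abbrev LanguageClass : Type (u + 1) := ∀ ⦃T : Type u⦄, Language T → Prop

/-- Indexed languages. -/
def Indexed : LanguageClass.{u} := fun _ L => ∃ g, FlagGrammar.IsIndexed g ∧ g.language = L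

/-- Linear indexed languages. -/
def LinearIndexed : LanguageClass.{u} := fun _ L =>
  ∃ g, FlagGrammar.IsLinearIndexed g ∧ g.language = L

/-- ET0L languages. -/
def ET0L : LanguageClass.{u} := fun _ L => ∃ h : ET0LSystem _, h.language = L

/-- EDT0L languages. -/
def EDT0L : LanguageClass.{u} := fun _ L => ∃ h : ET0LSystem _, h.IsDeterministic ∧ h.language = L

/-- Context-free languages. -/
def ContextFree : LanguageClass.{u} := fun _ L => L.IsContextFree

/-- Rational (that is, regular) languages. -/
def Rational : LanguageClass.{u} := fun _ L => L.IsRegular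

/-! ### Unfolded and two-tape relations -/

/-- The language `L_ρ = {u # v^rev | (u, v) ∈ ρ}` over `X ∪ {#}`, which is modelled by `Option X`
with `none` as the symbol `#`. -/
def unfoldedLanguage {X : Type u} (ρ : Set (List X × List X)) : Language (Option X) :=
  {w | ∃ u v : List X, (u, v) ∈ ρ ∧ w = u.map some ++ none :: v.reverse.map some}

/-- The map `(x₁, y₁) ⋯ (xₖ, yₖ) ↦ (x₁ ⋯ xₖ, y₁ ⋯ yₖ)` on words over
`(X ∪ {ε}) × (X ∪ {ε})`, where `X ∪ {ε}` is modelled by `Option X` with `none` as `ε`. -/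
def tapes {X : Type u} (w : List (Option X × Option X)) : List X × List X :=
  (w.filterMap Prod.fst, w.filterMap Prod.snd)

/-- `U(C)`, restricted to relations on `X*`. -/
def U (C : LanguageClass.{u}) (X : Type u) : Set (Set (List X × List X)) :=
  {ρ | C (unfoldedLanguage ρ)}

/-- `T(C)`, restricted to relations on `X*`. -/
def T (C : LanguageClass.{u}) (X : Type u) : Set (Set (List X × List X)) :=
  {ρ | ∃ L : Language (Option X × Option X), C L ∧ ρ = tapes '' L}

end WordRel

namespace WordRel

/-! A derivation of `u # v^rev` has a spine, the line of ancestors of `#`. What branches off to its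
left yields `u`, what branches off to its right yields `v^rev`. Folding the derivation at `#` turns
a sentential form `p b q`, with `b` on the spine, into `z b`, where `z` is a shuffle of `p` (in left
copies) and the reverse of `q` (in right copies). A spine production `A → α b β` becomes one that
emits `α` and the reverse of `β` before `b`. Left copies write on the first tape, right copies use
reversed productions and write on the second, so the tapes receive `u` and `v`. `Interleaves` is the
shuffle relation that ties the two kinds of sentential form together, and each direction of the
correspondence is an induction along a derivation.

For grammars this is `tapes_image_foldRules`. It allows infinitely many productions, so that an
indexed grammar can be viewed as a context-free one whose non-terminals carry stacks. Folding a flag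
grammar only relabels and permutes right-hand sides, which preserves being indexed and being linear
indexed.

For ET0L-systems the place where a spine word is split belongs to the table and not to the
production. This keeps tables deterministic and loses nothing, since a sentential form has only one
spine letter. Terminals may still be rewritten there, so all letters are simulated by non-terminals;
a final table converts them to terminals, and whatever should not survive becomes a dead letter.

For rational languages, an automaton runs forwards on the first tape and backwards on the second
until the two runs can be joined by reading `#`. -/

/-- The role that a symbol of a grammar for `u # v^rev` plays in the folded grammar: it contributes
to `u`, to `v`, or derives the word around `#`. -/
inductive Mode where
  | left
  | right
  | spine

instance : Finite Mode :=
  Finite.of_surjective (fun i : Fin 3 => if i = 0 then Mode.left else if i = 1 then .right else .spine)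
    (by rintro (_ | _ | _); exacts [⟨0, rfl⟩, ⟨1, rfl⟩, ⟨2, rfl⟩])

/-! ### Shuffles of two words -/

section Interleaves

variable {V V' : Type*} {l r : V → V'}

/-- `Interleaves l r z p q`: the word `z` is a shuffle of `p.map l` and `q.map r`. -/
inductive Interleaves (l r : V → V') : List V' → List V → List V → Prop
  | nil : Interleaves l r [] [] []
  | left (a : V) {z p q} : Interleaves l r z p q → Interleaves l r (l a :: z) (a :: p) q
  | right (a : V) {z p q} : Interleaves l r z p q → Interleaves l r (r a :: z) p (a :: q)

namespace Interleaves

theorem map_left (x : List V) : Interleaves l r (x.map l) x [] := by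
  induction x with
  | nil => exact .nil
  | cons a x ih => exact .left a ih

theorem map_right (x : List V) : Interleaves l r (x.map r) [] x := by
  induction x with
  | nil => exact .nil
  | cons a x ih => exact .right a ih

theorem append {z z' : List V'} {p p' q q' : List V} (h : Interleaves l r z p q)
    (h' : Interleaves l r z' p' q') : Interleaves l r (z ++ z') (p ++ p') (q ++ q') := by
  induction h with
  | nil => exact h'
  | left a _ ih => exact .left a ih
  | right a _ ih => exact .right a ih

theorem map_left_append_map_right (x y : List V) :
    Interleaves l r (x.map l ++ y.map r) x y := by
  simpa using (map_left x).append (map_right y)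

/-- The given letter has a place in the shuffle, and cutting there also cuts the other word. This
locates in a folded form the copy of a symbol that is rewritten off the spine. -/
theorem exists_of_left {z : List V'} {p p₁ p₂ q : List V} {a : V} (h : Interleaves l r z p q)
    (hp : p = p₁ ++ a :: p₂) : ∃ z₁ z₂ q₁ q₂, z = z₁ ++ l a :: z₂ ∧ q = q₁ ++ q₂ ∧
      Interleaves l r z₁ p₁ q₁ ∧ Interleaves l r z₂ p₂ q₂ := by
  induction h generalizing p₁ with
  | nil => simp at hp
  | @left b z p q h ih =>
    cases p₁ with
    | nil =>
      obtain ⟨rfl, rfl⟩ : b = a ∧ p = p₂ := by simpa using hp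
      exact ⟨[], z, [], q, rfl, rfl, .nil, h⟩
    | cons c p₁ =>
      obtain ⟨rfl, rfl⟩ : b = c ∧ p = p₁ ++ a :: p₂ := by simpa using hp
      obtain ⟨z₁, z₂, q₁, q₂, rfl, rfl, h₁, h₂⟩ := ih rfl
      exact ⟨l b :: z₁, z₂, q₁, q₂, rfl, rfl, .left b h₁, h₂⟩
  | @right b z p q h ih =>
    obtain ⟨z₁, z₂, q₁, q₂, rfl, rfl, h₁, h₂⟩ := ih hp
    exact ⟨r b :: z₁, z₂, b :: q₁, q₂, rfl, rfl, .right b h₁, h₂⟩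

theorem swap {z : List V'} {p q : List V} (h : Interleaves l r z p q) :
    Interleaves r l z q p := by
  induction h with
  | nil => exact .nil
  | left a _ ih => exact .right a ih
  | right a _ ih => exact .left a ih

theorem exists_of_right {z : List V'} {p q q₁ q₂ : List V} {a : V} (h : Interleaves l r z p q)
    (hq : q = q₁ ++ a :: q₂) : ∃ z₁ z₂ p₁ p₂, z = z₁ ++ r a :: z₂ ∧ p = p₁ ++ p₂ ∧
      Interleaves l r z₁ p₁ q₁ ∧ Interleaves l r z₂ p₂ q₂ := by
  obtain ⟨z₁, z₂, p₁, p₂, hz, hp, h₁, h₂⟩ := h.swap.exists_of_left hq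
  exact ⟨z₁, z₂, p₁, p₂, hz, hp, h₁.swap, h₂.swap⟩

theorem exists_of_append {z z₁ z₂ : List V'} {p q : List V} (h : Interleaves l r z p q)
    (hz : z = z₁ ++ z₂) : ∃ p₁ p₂ q₁ q₂, p = p₁ ++ p₂ ∧ q = q₁ ++ q₂ ∧
      Interleaves l r z₁ p₁ q₁ ∧ Interleaves l r z₂ p₂ q₂ := by
  induction h generalizing z₁ with
  | nil =>
    obtain ⟨rfl, rfl⟩ : z₁ = [] ∧ z₂ = [] := by simpa using hz
    exact ⟨[], [], [], [], rfl, rfl, .nil, .nil⟩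
  | @left b z p q h ih =>
    cases z₁ with
    | nil => exact ⟨[], b :: p, [], q, rfl, rfl, .nil, by subst hz; exact .left b h⟩
    | cons c z₁ =>
      obtain ⟨rfl, hz'⟩ : l b = c ∧ z = z₁ ++ z₂ := by simpa using hz
      obtain ⟨p₁, p₂, q₁, q₂, rfl, rfl, h₁, h₂⟩ := ih hz'
      exact ⟨b :: p₁, p₂, q₁, q₂, rfl, rfl, .left b h₁, h₂⟩
  | @right b z p q h ih =>
    cases z₁ with
    | nil => exact ⟨[], p, [], b :: q, rfl, rfl, .nil, by subst hz; exact .right b h⟩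
    | cons c z₁ =>
      obtain ⟨rfl, hz'⟩ : r b = c ∧ z = z₁ ++ z₂ := by simpa using hz
      obtain ⟨p₁, p₂, q₁, q₂, rfl, rfl, h₁, h₂⟩ := ih hz'
      exact ⟨p₁, p₂, b :: q₁, q₂, rfl, rfl, .right b h₁, h₂⟩

/-- A letter of the shuffle comes from exactly one of the two words. This carries a folded step back
to the original sentential form. -/
theorem exists_of_append_cons {z₁ z₂ : List V'} {p q : List V} {c : V'}
    (h : Interleaves l r (z₁ ++ c :: z₂) p q) : ∃ p₁ p₂ q₁ q₂ a,
      Interleaves l r z₁ p₁ q₁ ∧ Interleaves l r z₂ p₂ q₂ ∧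
      (c = l a ∧ p = p₁ ++ a :: p₂ ∧ q = q₁ ++ q₂ ∨ c = r a ∧ p = p₁ ++ p₂ ∧ q = q₁ ++ a :: q₂) := by
  obtain ⟨p₁, p₂, q₁, q₂, rfl, rfl, h₁, h₂⟩ := h.exists_of_append rfl
  generalize hy : c :: z₂ = y at h₂
  cases h₂ with
  | nil => simp at hy
  | left a h₂ =>
    obtain ⟨rfl, rfl⟩ := List.cons.inj hy
    exact ⟨p₁, _, q₁, _, a, h₁, h₂, .inl ⟨rfl, rfl, rfl⟩⟩
  | right a h₂ =>
    obtain ⟨rfl, rfl⟩ := List.cons.inj hy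
    exact ⟨p₁, _, q₁, _, a, h₁, h₂, .inr ⟨rfl, rfl, rfl⟩⟩

end Interleaves

end Interleaves

/-- The right-hand word contains `#` only once, so there is only one place to cut, although `p` and
`q` might a priori contain `#`. -/
theorem eq_of_append_none_cons_eq {X : Type*} {p q : List (Option X)} {u v : List X}
    (h : p ++ none :: q = u.map some ++ none :: v.map some) :
    p = u.map some ∧ q = v.map some := by
  induction p generalizing u with
  | nil =>
    cases u with
    | nil => simpa using h
    | cons a u => simp at h
  | cons c p ih =>
    cases u with
    | nil =>
      have : (none : Option X) ∈ v.map some := by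
        simp only [List.cons_append, List.map_nil, List.nil_append, List.cons.injEq] at h
        rw [← h.2]; simp
      simp at this
    | cons a u =>
      simp only [List.cons_append, List.map_cons, List.cons.injEq] at h
      obtain ⟨h₁, h₂⟩ := ih h.2
      exact ⟨by rw [h₁, h.1, List.map_cons], h₂⟩

/-! ### Folding context-free rewriting at the spine -/

section Fold

variable {X : Type u} {I I' N N' : Type}

/-- The letter over the two tapes that is written for a terminal in a given mode. -/
def tapeLetter : Mode → Option X → Option X × Option X
  | .left, o => (o, none)
  | .right, o => (none, o)
  | .spine, _ => (none, none)

/-- The copy of a symbol in a given mode. -/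
def modeCopy (f : Mode → N → N') (m : Mode) :
    Symbol (Option X) N → Symbol (Option X × Option X) N'
  | .terminal o => .terminal (tapeLetter m o)
  | .nonterminal A => .nonterminal (f m A)

/-- The symbols from which `#` may still be derived. -/
def MayYieldHash (b : Symbol (Option X) N) : Prop := ∀ x, b ≠ .terminal (some x)

/-- The productions of the folded grammar. A production `A → x` is copied for the first tape and,
reversed, for the second; on the spine, `A → α b β` becomes a production that writes `α` on the
first tape, `β` reversed on the second, and goes on with `b`. -/
def foldRules (h : Mode → I → I') (f : Mode → N → N') (R : Set (I × List (Symbol (Option X) N))) :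
    Set (I' × List (Symbol (Option X × Option X) N')) :=
  {r | ∃ A x, (A, x) ∈ R ∧ (r = (h .left A, x.map (modeCopy f .left)) ∨
    r = (h .right A, x.reverse.map (modeCopy f .right)) ∨
    ∃ α b β, x = α ++ b :: β ∧ MayYieldHash b ∧ r = (h .spine A,
      α.map (modeCopy f .left) ++ β.reverse.map (modeCopy f .right) ++ [modeCopy f .spine b]))}

theorem finite_splits {V : Type*} (x : List V) :
    {s : List V × V × List V | x = s.1 ++ s.2.1 :: s.2.2}.Finite := by
  induction x with
  | nil => simp
  | cons a x ih =>
    refine ((ih.image fun s => (a :: s.1, s.2)).insert ([], a, x)).subset ?_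
    rintro ⟨_ | ⟨c, α⟩, b, β⟩ hs
    · obtain ⟨rfl, rfl⟩ : a = b ∧ x = β := by simpa using hs
      exact .inl rfl
    · obtain ⟨rfl, rfl⟩ : a = c ∧ x = α ++ b :: β := by simpa using hs
      exact .inr ⟨(α, b, β), rfl, rfl⟩

theorem finite_foldRules (h : Mode → I → I') (f : Mode → N → N')
    {R : Set (I × List (Symbol (Option X) N))} (hR : R.Finite) : (foldRules h f R).Finite := by
  refine (hR.biUnion (t := fun c => insert (h .left c.1, c.2.map (modeCopy f .left))
    (insert (h .right c.1, c.2.reverse.map (modeCopy f .right))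
      ((fun s : List _ × _ × List _ => (h .spine c.1, s.1.map (modeCopy f .left) ++
        s.2.2.reverse.map (modeCopy f .right) ++ [modeCopy f .spine s.2.1])) ''
          {s | c.2 = s.1 ++ s.2.1 :: s.2.2}))) fun c _ =>
      (((finite_splits c.2).image _).insert _).insert _).subset ?_
  rintro r ⟨A, x, hx, rfl | rfl | ⟨α, b, β, hs, -, rfl⟩⟩
  · exact Set.mem_biUnion hx (.inl rfl)
  · exact Set.mem_biUnion hx (.inr (.inl rfl))
  · exact Set.mem_biUnion hx (.inr (.inr ⟨(α, b, β), hs, rfl⟩))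

/-- One step of context-free rewriting by a possibly infinite set of productions. -/
def Rewrites {T : Type*} {N : Type*} (R : Set (N × List (Symbol T N))) (w w' : List (Symbol T N)) :
    Prop :=
  ∃ A x p q, (A, x) ∈ R ∧ w = p ++ .nonterminal A :: q ∧ w' = p ++ x ++ q

open Relation

theorem append_eq_append_cons {V : Type*} {P Q p q : List V} {b : V} (h : P ++ Q = p ++ b :: q) :
    (∃ q₁, P = p ++ b :: q₁ ∧ q = q₁ ++ Q) ∨ ∃ p₂, p = P ++ p₂ ∧ Q = p₂ ++ b :: q := by
  induction P generalizing p with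
  | nil => exact .inr ⟨p, rfl, h⟩
  | cons a P ih =>
    cases p with
    | nil =>
      obtain ⟨rfl, rfl⟩ : a = b ∧ P ++ Q = q := by simpa using h
      exact .inl ⟨P, rfl, rfl⟩
    | cons c p =>
      obtain ⟨rfl, h'⟩ : a = c ∧ P ++ Q = p ++ b :: q := by simpa using h
      obtain ⟨q₁, rfl, rfl⟩ | ⟨p₂, rfl, rfl⟩ := ih h'
      · exact .inl ⟨q₁, rfl, rfl⟩
      · exact .inr ⟨p₂, rfl, rfl⟩

/-- The symbol `b` is the ancestor in `w₀` of the marked `#`; it is traced back one step at a time.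
Every shuffle `z` must be allowed, because earlier steps of the folded derivation determine the
order in which the two sides are mixed. -/
theorem Rewrites.exists_spine {f : Mode → N → N'} {R : Set (N × List (Symbol (Option X) N))}
    {w₀ p₀ q₀ : List (Symbol (Option X) N)}
    (hw : ReflTransGen (Rewrites R) w₀ (p₀ ++ .terminal none :: q₀)) :
    ∃ p b q, w₀ = p ++ b :: q ∧ MayYieldHash b ∧
      ∀ z, Interleaves (modeCopy f .left) (modeCopy f .right) z p q.reverse →
        ∃ z', Interleaves (modeCopy f .left) (modeCopy f .right) z' p₀ q₀.reverse ∧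
          ReflTransGen (Rewrites (foldRules f f R)) (z ++ [modeCopy f .spine b])
            (z' ++ [.terminal (none, none)]) := by
  induction hw using ReflTransGen.head_induction_on with
  | refl => exact ⟨p₀, .terminal none, q₀, rfl, by simp [MayYieldHash], fun z hz => ⟨z, hz, .refl⟩⟩
  | @head w₁ w₂ h₁ _ ih =>
    obtain ⟨p, b, q, rfl, hb, ih⟩ := ih
    obtain ⟨A, x, P, Q, hR, rfl, hx⟩ := h₁
    -- The spine symbol lies before the inserted word `x`, inside it, or after it. Accordingly the
    -- step is simulated by a right, a spine or a left production.
    obtain ⟨q₁, hx', rfl⟩ | ⟨p₂, rfl, rfl⟩ := append_eq_append_cons hx.symm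
    · obtain ⟨q₂, rfl, rfl⟩ | ⟨x₁, rfl, rfl⟩ := append_eq_append_cons hx'
      · refine ⟨p, b, q₂ ++ .nonterminal A :: Q, by simp, hb, fun z hz => ?_⟩
        obtain ⟨z₁, z₂, p₁, p₂, rfl, rfl, h₁, h₂⟩ :=
          hz.exists_of_right (q₁ := Q.reverse) (q₂ := q₂.reverse) (a := .nonterminal A) (by simp)
        obtain ⟨z', hz', hd⟩ := ih (z₁ ++ (x.reverse.map (modeCopy f .right) ++ z₂)) (by
          simpa using h₁.append ((Interleaves.map_right x.reverse).append h₂))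
        exact ⟨z', hz', .head ⟨f .right A, x.reverse.map (modeCopy f .right), z₁,
          z₂ ++ [modeCopy f .spine b], ⟨A, x, hR, .inr (.inl rfl)⟩, by simp [modeCopy], by simp⟩ hd⟩
      · refine ⟨P, .nonterminal A, Q, rfl, by simp [MayYieldHash], fun z hz => ?_⟩
        obtain ⟨z', hz', hd⟩ := ih (z ++ (x₁.map (modeCopy f .left) ++
          q₁.reverse.map (modeCopy f .right))) (by
            simpa using hz.append (Interleaves.map_left_append_map_right x₁ q₁.reverse))
        exact ⟨z', hz', .head ⟨f .spine A, _, z, [],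
          ⟨A, _, hR, .inr (.inr ⟨x₁, b, q₁, rfl, hb, rfl⟩)⟩, by simp [modeCopy], by simp⟩ hd⟩
    · refine ⟨P ++ .nonterminal A :: p₂, b, q, by simp, hb, fun z hz => ?_⟩
      obtain ⟨z₁, z₂, q₁, q₂, rfl, hq, h₁, h₂⟩ := hz.exists_of_left rfl
      obtain ⟨z', hz', hd⟩ := ih (z₁ ++ (x.map (modeCopy f .left) ++ z₂)) (by
        rw [hq]; simpa using h₁.append ((Interleaves.map_left x).append h₂))
      exact ⟨z', hz', .head ⟨f .left A, x.map (modeCopy f .left), z₁, z₂ ++ [modeCopy f .spine b],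
        ⟨A, x, hR, .inl rfl⟩, by simp [modeCopy], by simp⟩ hd⟩

/-- Distinct copies of non-terminals are distinct. -/
def ModeInjective (f : Mode → N → N') : Prop :=
  ∀ ⦃m A m' A'⦄, f m A = f m' A' → m = m' ∧ A = A'

theorem modeCopy_eq_nonterminal {f : Mode → N → N'} {m : Mode} {b : Symbol (Option X) N} {B : N'}
    (h : modeCopy f m b = .nonterminal B) : ∃ A, b = .nonterminal A ∧ f m A = B := by
  cases b with
  | terminal o => simp [modeCopy] at h
  | nonterminal A => exact ⟨A, rfl, by simpa [modeCopy] using h⟩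

/-- A folded form always ends in its only spine symbol. A step inside `z` rewrites a symbol of `p`
or `q`, and a step at the end extends the spine; mode injectivity ensures that the production used
is of the matching kind. -/
theorem exists_rewrites_of_folded {f : Mode → N → N'} (hf : ModeInjective f)
    {R : Set (N × List (Symbol (Option X) N))} {S : N} {w : List (Symbol (Option X × Option X) N')}
    (hw : ReflTransGen (Rewrites (foldRules f f R)) [.nonterminal (f .spine S)] w) :
    ∃ z p b q, w = z ++ [modeCopy f .spine b] ∧ MayYieldHash b ∧
      Interleaves (modeCopy f .left) (modeCopy f .right) z p q.reverse ∧
      ReflTransGen (Rewrites R) [.nonterminal S] (p ++ b :: q) := by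
  induction hw with
  | refl => exact ⟨[], [], .nonterminal S, [], rfl, by simp [MayYieldHash], .nil, .refl⟩
  | tail _ h ih =>
    obtain ⟨z, p, b, q, rfl, hb, hz, hd⟩ := ih
    obtain ⟨B, y, P, Q, hR, hP, rfl⟩ := h
    obtain ⟨z₂, rfl, rfl⟩ | ⟨z₂, rfl, hQ⟩ := append_eq_append_cons hP
    · obtain ⟨p₁, p₂, q₁, q₂, a, h₁, h₂, ⟨ha, rfl, hq⟩ | ⟨ha, rfl, hq⟩⟩ := hz.exists_of_append_cons
      · obtain ⟨A, rfl, hA⟩ := modeCopy_eq_nonterminal ha.symm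
        obtain ⟨A', x, hx, hr | hr | ⟨α, b', β, -, -, hr⟩⟩ := hR <;>
          obtain ⟨hB, rfl⟩ := Prod.mk.inj hr <;> obtain ⟨hm, rfl⟩ := hf (hA.trans hB) <;> cases hm
        refine ⟨P ++ (x.map (modeCopy f .left) ++ z₂), p₁ ++ (x ++ p₂), b, q, by simp, hb, ?_,
          hd.tail ⟨A, x, p₁, p₂ ++ b :: q, hx, by simp, by simp⟩⟩
        rw [hq]
        simpa using h₁.append ((Interleaves.map_left x).append h₂)
      · obtain ⟨A, rfl, hA⟩ := modeCopy_eq_nonterminal ha.symm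
        obtain ⟨A', x, hx, hr | hr | ⟨α, b', β, -, -, hr⟩⟩ := hR <;>
          obtain ⟨hB, rfl⟩ := Prod.mk.inj hr <;> obtain ⟨hm, rfl⟩ := hf (hA.trans hB) <;> cases hm
        obtain rfl : q = q₂.reverse ++ .nonterminal A :: q₁.reverse := by
          rw [← q.reverse_reverse, hq]; simp
        refine ⟨P ++ (x.reverse.map (modeCopy f .right) ++ z₂), p₁ ++ p₂, b,
          q₂.reverse ++ x ++ q₁.reverse, by simp, hb, ?_,
          hd.tail ⟨A, x, p₁ ++ p₂ ++ b :: q₂.reverse, q₁.reverse, hx, by simp, by simp⟩⟩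
        simpa using h₁.append ((Interleaves.map_right x.reverse).append h₂)
    · obtain ⟨rfl, hb', rfl⟩ : z₂ = [] ∧ modeCopy f .spine b = .nonterminal B ∧ Q = [] := by
        cases z₂ <;> simp_all
      obtain ⟨A, rfl, hA⟩ := modeCopy_eq_nonterminal hb'
      obtain ⟨A', x, hx, hr | hr | ⟨α, b, β, rfl, hb, hr⟩⟩ := hR <;>
        obtain ⟨hB, rfl⟩ := Prod.mk.inj hr <;> obtain ⟨hm, rfl⟩ := hf (hA.trans hB) <;> cases hm
      refine ⟨z ++ (α.map (modeCopy f .left) ++ β.reverse.map (modeCopy f .right)), p ++ α, b,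
        β ++ q, by simp, hb, ?_, hd.tail ⟨A, _, p, q, hx, rfl, by simp⟩⟩
      simpa using hz.append (Interleaves.map_left_append_map_right α β.reverse)

theorem Interleaves.exists_terminal {f : Mode → N → N'}
    {w : List (Symbol (Option X × Option X) N')} {u v : List X}
    (h : Interleaves (modeCopy f .left) (modeCopy f .right) w
      (u.map (.terminal ∘ some)) (v.map (.terminal ∘ some))) :
    ∃ t, w = t.map .terminal ∧ tapes t = (u, v) := by
  generalize hp : u.map (Symbol.terminal (N := N) ∘ some) = p at h
  generalize hq : v.map (Symbol.terminal (N := N) ∘ some) = q at h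
  induction h generalizing u v with
  | nil => simp_all [tapes]
  | left a _ ih =>
    obtain ⟨x, u, rfl, rfl, hu⟩ := List.map_eq_cons_iff.1 hp
    obtain ⟨t, rfl, ht⟩ := ih hu hq
    exact ⟨(some x, none) :: t, rfl, by simp_all [tapes]⟩
  | right a _ ih =>
    obtain ⟨x, v, rfl, rfl, hv⟩ := List.map_eq_cons_iff.1 hq
    obtain ⟨t, rfl, ht⟩ := ih hp hv
    exact ⟨(none, some x) :: t, rfl, by simp_all [tapes]⟩

theorem Interleaves.exists_eq_map_terminal {f : Mode → N → N'}
    {t : List (Option X × Option X)} {p q : List (Symbol (Option X) N)}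
    (h : Interleaves (modeCopy f .left) (modeCopy f .right) (t.map .terminal) p q) :
    ∃ p₀ q₀ : List (Option X), p = p₀.map .terminal ∧ q = q₀.map .terminal := by
  generalize hw : t.map (Symbol.terminal (N := N')) = w at h
  induction h generalizing t with
  | nil => exact ⟨[], [], rfl, rfl⟩
  | left a _ ih =>
    obtain ⟨c, t, rfl, ha, ht⟩ := List.map_eq_cons_iff.1 hw
    obtain ⟨p₀, q₀, rfl, rfl⟩ := ih ht
    cases a with
    | terminal o => exact ⟨o :: p₀, q₀, rfl, rfl⟩
    | nonterminal A => simp [modeCopy] at ha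
  | right a _ ih =>
    obtain ⟨c, t, rfl, ha, ht⟩ := List.map_eq_cons_iff.1 hw
    obtain ⟨p₀, q₀, rfl, rfl⟩ := ih ht
    cases a with
    | terminal o => exact ⟨p₀, o :: q₀, rfl, rfl⟩
    | nonterminal A => simp [modeCopy] at ha

/-- The folded grammar generates a language that maps to `ρ`. -/
theorem tapes_image_foldRules {f : Mode → N → N'} (hf : ModeInjective f)
    {R : Set (N × List (Symbol (Option X) N))} {S : N} {ρ : Set (List X × List X)}
    (hρ : {w | ReflTransGen (Rewrites R) [.nonterminal S] (w.map .terminal)} =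
      unfoldedLanguage ρ) :
    ρ = tapes '' {t | ReflTransGen (Rewrites (foldRules f f R)) [.nonterminal (f .spine S)]
      (t.map .terminal)} := by
  ext ⟨u, v⟩
  constructor
  · intro h
    have hd : u.map some ++ none :: v.reverse.map some ∈ unfoldedLanguage ρ := ⟨u, v, h, rfl⟩
    rw [← hρ] at hd
    have hd : ReflTransGen (Rewrites R) [.nonterminal S]
        (u.map (.terminal ∘ some) ++ .terminal none :: v.reverse.map (.terminal ∘ some)) := by
      simpa using Set.mem_ofPred.1 hd
    obtain ⟨p, b, q, hw, -, hz⟩ := Rewrites.exists_spine (f := f) hd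
    obtain ⟨rfl, rfl, rfl⟩ : p = [] ∧ .nonterminal S = b ∧ q = [] := by
      cases p <;> simp_all
    obtain ⟨z, hz, hd⟩ := hz [] .nil
    obtain ⟨t, rfl, ht⟩ := Interleaves.exists_terminal (u := u) (v := v) (by simpa using hz)
    -- The `#` at the end of the spine leaves behind the letter `(ε, ε)`, which both tapes ignore.
    exact ⟨t ++ [(none, none)], by simpa [modeCopy] using hd, by simpa [tapes] using ht⟩
  · rintro ⟨t, ht, huv⟩
    obtain ⟨z, p, b, q, hw, hb, hz, hd⟩ := exists_rewrites_of_folded hf ht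
    obtain ⟨t₁, t₂, rfl, rfl, ht₂⟩ := List.map_eq_append_iff.1 hw
    obtain ⟨c, t₃, rfl, hc, ht₃⟩ := List.map_eq_cons_iff.1 ht₂
    obtain rfl : t₃ = [] := by simpa using ht₃
    -- Spine mode erases every terminal, so `MayYieldHash` is needed to exclude that a letter of `X`
    -- was lost here.
    obtain ⟨rfl, rfl⟩ : b = .terminal none ∧ c = (none, none) := by
      rcases b with (_ | x) | A
      · simpa [modeCopy, tapeLetter] using hc
      · exact absurd rfl (hb x)
      · simp [modeCopy] at hc
    obtain ⟨p₀, q₀, rfl, hq⟩ := hz.exists_eq_map_terminal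
    obtain rfl : q = q₀.reverse.map .terminal := by rw [← q.reverse_reverse, hq]; simp
    have hm : p₀ ++ none :: q₀.reverse ∈ unfoldedLanguage ρ := by
      rw [← hρ]
      refine Set.mem_ofPred.2 ?_
      simpa using hd
    obtain ⟨u', v', h', he⟩ := hm
    obtain ⟨rfl, hq⟩ := eq_of_append_none_cons_eq he
    obtain rfl : q₀ = v'.map some := by rw [← q₀.reverse_reverse, hq]; simp
    obtain ⟨t, ht, htu⟩ := Interleaves.exists_terminal (u := u') (v := v') (by simpa using hz)
    obtain rfl := List.map_injective_iff.2 (fun _ _ h => Symbol.terminal.inj h) ht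
    have : (u, v) = (u', v') := by rw [← htu, ← huv]; simp [tapes]
    rwa [this]

end Fold

/-! ### Context-free, indexed and linear indexed grammars -/

section Grammars

open Relation

variable {X : Type u}

theorem contextFree_produces_eq_rewrites {T : Type u} (g : ContextFreeGrammar T) :
    g.Produces = Rewrites {c | ⟨c.1, c.2⟩ ∈ g.rules} := by
  ext w w'
  constructor
  · rintro ⟨r, hr, h⟩
    obtain ⟨p, q, rfl, rfl⟩ := h.exists_parts
    exact ⟨r.input, r.output, p, q, hr, by simp, rfl⟩
  · rintro ⟨A, x, p, q, hr, rfl, rfl⟩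
    exact ⟨⟨A, x⟩, hr, ContextFreeRule.rewrites_iff.2 ⟨p, q, by simp, rfl⟩⟩

theorem modeInjective_prodMk {N : Type} : ModeInjective (Prod.mk : Mode → N → Mode × N) :=
  fun _ _ _ _ h => Prod.mk.inj h

theorem U_contextFree_subset_T : U ContextFree X ⊆ T ContextFree X := by
  rintro ρ ⟨g, hg⟩
  have hR : {c : g.NT × _ | ⟨c.1, c.2⟩ ∈ g.rules}.Finite :=
    g.rules.finite_toSet.preimage (f := fun c : g.NT × _ => ContextFreeRule.mk c.1 c.2)
      fun a _ b _ h => by simpa [Prod.ext_iff] using h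
  have hfin := (finite_foldRules Prod.mk Prod.mk hR).image fun c => ContextFreeRule.mk c.1 c.2
  refine ⟨_, ⟨⟨Mode × g.NT, (.spine, g.initial), hfin.toFinset⟩, rfl⟩, ?_⟩
  have hrules : {c : (Mode × g.NT) × List (Symbol (Option X × Option X) (Mode × g.NT)) |
      ⟨c.1, c.2⟩ ∈ hfin.toFinset} =
      foldRules Prod.mk Prod.mk {c | ⟨c.1, c.2⟩ ∈ g.rules} := by
    ext ⟨A, x⟩
    simp
  have := tapes_image_foldRules modeInjective_prodMk (S := g.initial) (ρ := ρ)
    (R := {c | ⟨c.1, c.2⟩ ∈ g.rules}) (by rw [← hg, ← contextFree_produces_eq_rewrites]; rfl)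
  rw [← hrules] at this
  refine this.trans (congrArg _ ?_)
  unfold ContextFreeGrammar.language ContextFreeGrammar.Generates ContextFreeGrammar.Derives
  rw [contextFree_produces_eq_rewrites]

namespace FlagGrammar

variable {T : Type u}

/-- The productions of the infinite context-free grammar whose non-terminals are the given
non-terminals together with a stack of flags. -/
def instances {N F : Type} (rules : Set (FlagRule T N F)) :
    Set ((N × List F) × List (Symbol T (N × List F))) :=
  {c | ∃ r ∈ rules, ∃ s, c = ((r.input, r.pop.toList ++ s),
    r.output.map (FlagOccurrence.toSymbol s))}

/-- Once the stack is part of the non-terminal, rewriting no longer depends on anything else, so the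
general folding applies. -/
theorem produces_eq_rewrites (g : FlagGrammar T) : g.Produces = Rewrites (instances g.rules) := by
  ext w w'
  constructor
  · rintro ⟨r, hr, s, p, q, rfl, rfl⟩
    exact ⟨_, _, p, q, ⟨r, hr, s, rfl⟩, by simp, rfl⟩
  · rintro ⟨A, x, p, q, ⟨r, hr, s, hc⟩, rfl, rfl⟩
    obtain ⟨rfl, rfl⟩ := Prod.mk.inj hc
    exact ⟨r, hr, s, p, q, by simp, rfl⟩

/-- The copy of a pair in a given mode. -/
def modePair {N K : Type} (m : Mode) (A : N × K) : (Mode × N) × K := ((m, A.1), A.2)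

/-- The copy of an occurrence of a non-terminal in a given mode. -/
def modeOccurrence {N F : Type} (m : Mode) (B : FlagOccurrence N F) :
    FlagOccurrence (Mode × N) F :=
  ⟨(m, B.nt), B.push, B.inherits⟩

theorem modeInjective_modePair {N K : Type} :
    ModeInjective (modePair : Mode → N × K → (Mode × N) × K) := by
  rintro m ⟨A, k⟩ m' ⟨A', k'⟩ h
  simp_all [modePair]

/-- The folded productions of a grammar with flags. -/
def foldFlagRules {N F : Type} (rules : Set (FlagRule (Option X) N F)) :
    Set (FlagRule (Option X × Option X) (Mode × N) F) :=
  {r | ((r.input, r.pop), r.output) ∈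
    foldRules modePair modeOccurrence {c | ⟨c.1.1, c.1.2, c.2⟩ ∈ rules}}

theorem finite_foldFlagRules {N F : Type} {rules : Set (FlagRule (Option X) N F)}
    (h : rules.Finite) : (foldFlagRules rules).Finite := by
  have hR : {c : (N × Option F) × _ | ⟨c.1.1, c.1.2, c.2⟩ ∈ rules}.Finite :=
    h.preimage (f := fun c : (N × Option F) × _ => FlagRule.mk c.1.1 c.1.2 c.2)
      fun a _ b _ h => by simpa [Prod.ext_iff, and_assoc] using h
  refine (finite_foldRules modePair modeOccurrence hR).preimage
    (f := fun r : FlagRule (Option X × Option X) (Mode × N) F =>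
      ((r.input, r.pop), r.output)) fun a _ b _ h => ?_
  cases a; cases b
  simpa [and_assoc] using h

/-- The grammar over two tapes for a grammar that generates words `u # v^rev`. -/
def fold (g : FlagGrammar (Option X)) : FlagGrammar (Option X × Option X) where
  NT := Mode × g.NT
  Flag := g.Flag
  finite_NT := have := g.finite_NT; inferInstance
  finite_Flag := g.finite_Flag
  initial := (.spine, g.initial)
  rules := foldFlagRules g.rules
  finite_rules := finite_foldFlagRules g.finite_rules

theorem toSymbol_modeCopy {N F : Type} (s : List F) (m : Mode)
    (b : Symbol (Option X) (FlagOccurrence N F)) :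
    FlagOccurrence.toSymbol s (modeCopy modeOccurrence m b) =
      modeCopy modePair m (FlagOccurrence.toSymbol s b) := by
  cases b <;> rfl

theorem map_toSymbol_map_modeCopy {N F : Type} (s : List F) (m : Mode)
    (x : List (Symbol (Option X) (FlagOccurrence N F))) :
    (x.map (modeCopy modeOccurrence m)).map (FlagOccurrence.toSymbol s) =
      (x.map (FlagOccurrence.toSymbol s)).map (modeCopy modePair m) := by
  simp [toSymbol_modeCopy]

theorem mayYieldHash_toSymbol {N F : Type} (s : List F)
    (b : Symbol (Option X) (FlagOccurrence N F)) :
    MayYieldHash (FlagOccurrence.toSymbol s b) ↔ MayYieldHash b := by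
  cases b <;> simp [MayYieldHash, FlagOccurrence.toSymbol]

/-- Attaching stacks acts symbol by symbol and in the same way in every mode, so it commutes with
folding. Hence the finite folded flag grammar presents the infinite folded grammar. -/
theorem instances_foldFlagRules {N F : Type} (rules : Set (FlagRule (Option X) N F)) :
    instances (foldFlagRules rules) = foldRules modePair modePair (instances rules) := by
  ext c
  constructor
  · rintro ⟨⟨i, o, x'⟩, ⟨⟨A, o⟩, x, hx, hr⟩, s, rfl⟩
    refine ⟨(A, o.toList ++ s), _, ⟨_, hx, s, rfl⟩, ?_⟩
    obtain hr | hr | ⟨α, b, β, rfl, hb, hr⟩ := hr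
    · simp only [modePair, Prod.mk.injEq] at hr
      obtain ⟨⟨rfl, rfl⟩, rfl⟩ := hr
      exact .inl (by rw [map_toSymbol_map_modeCopy]; rfl)
    · simp only [modePair, Prod.mk.injEq] at hr
      obtain ⟨⟨rfl, rfl⟩, rfl⟩ := hr
      exact .inr (.inl (by rw [map_toSymbol_map_modeCopy]; simp only [List.map_reverse]; rfl))
    · simp only [modePair, Prod.mk.injEq] at hr
      obtain ⟨⟨rfl, rfl⟩, rfl⟩ := hr
      refine .inr (.inr ⟨_, _, _, List.map_append, (mayYieldHash_toSymbol s b).2 hb, ?_⟩)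
      simp only [List.map_append, map_toSymbol_map_modeCopy, List.map_reverse, List.map_cons,
        toSymbol_modeCopy, List.map_nil]
      rfl
  · rintro ⟨_, _, ⟨⟨A, o, x⟩, hx, s, hc⟩, h⟩
    obtain ⟨rfl, rfl⟩ := Prod.mk.inj hc
    obtain rfl | rfl | ⟨α, b, β, hs, hb, rfl⟩ := h
    · exact ⟨⟨_, o, _⟩, ⟨(A, o), x, hx, .inl rfl⟩, s, by rw [map_toSymbol_map_modeCopy]; rfl⟩
    · exact ⟨⟨_, o, _⟩, ⟨(A, o), x, hx, .inr (.inl rfl)⟩, s, by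
        rw [map_toSymbol_map_modeCopy]; simp only [List.map_reverse]; rfl⟩
    · obtain ⟨α, y, rfl, rfl, hy⟩ := List.map_eq_append_iff.1 hs
      obtain ⟨b, β, rfl, rfl, rfl⟩ := List.map_eq_cons_iff.1 hy
      refine ⟨⟨_, o, _⟩, ⟨(A, o), _, hx, .inr (.inr ⟨α, b, β, rfl,
        (mayYieldHash_toSymbol s b).1 hb, rfl⟩)⟩, s, ?_⟩
      simp only [List.map_append, map_toSymbol_map_modeCopy, List.map_reverse, List.map_cons,
        toSymbol_modeCopy, List.map_nil]
      rfl

theorem tapes_image_language_fold (g : FlagGrammar (Option X)) {ρ : Set (List X × List X)}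
    (hρ : g.language = unfoldedLanguage ρ) : ρ = tapes '' (g.fold.language : Set _) := by
  unfold language at hρ ⊢
  rw [produces_eq_rewrites] at hρ ⊢
  have := tapes_image_foldRules modeInjective_modePair hρ
  rw [← instances_foldFlagRules] at this
  exact this

theorem inheritsFlags_modeCopy {N F : Type} (m : Mode)
    (b : Symbol (Option X) (FlagOccurrence N F)) :
    inheritsFlags (modeCopy modeOccurrence m b) = inheritsFlags b := by
  cases b <;> rfl

/-- Folding relabels and reorders the right-hand side but neither drops nor duplicates a symbol, so
the number of inheriting occurrences is unchanged. -/
theorem exists_of_mem_foldFlagRules {N F : Type} {rules : Set (FlagRule (Option X) N F)}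
    {r' : FlagRule (Option X × Option X) (Mode × N) F} (h : r' ∈ foldFlagRules rules) :
    ∃ r ∈ rules, (r'.output.map inheritsFlags).Perm (r.output.map inheritsFlags) := by
  have hcopy (m : Mode) : inheritsFlags ∘ modeCopy (X := X) (modeOccurrence (N := N)
      (F := F)) m = inheritsFlags := funext (inheritsFlags_modeCopy m)
  obtain ⟨⟨A, o⟩, x, hx, h⟩ := h
  refine ⟨_, hx, ?_⟩
  obtain h | h | ⟨α, b, β, rfl, -, h⟩ := h
  · rw [(Prod.mk.inj h).2, List.map_map, hcopy]
  · rw [(Prod.mk.inj h).2, List.map_map, hcopy]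
    exact x.reverse_perm.map _
  · rw [(Prod.mk.inj h).2]
    simp only [List.map_append, List.map_map, hcopy, List.map_cons, inheritsFlags_modeCopy,
      List.map_nil, List.append_assoc]
    refine List.Perm.append_left _ ((List.perm_append_comm).trans ?_)
    exact ((List.reverse_perm β).map _).cons _

theorem IsLinearIndexed.fold {g : FlagGrammar (Option X)} (hg : g.IsLinearIndexed) :
    g.fold.IsLinearIndexed := by
  intro r' hr'
  obtain ⟨r, hr, hp⟩ := exists_of_mem_foldFlagRules hr'
  have := hp.countP_eq id
  rw [List.countP_map, List.countP_map] at this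
  exact this.trans_le (hg r hr)

theorem exists_mem_output_of_mem_foldFlagRules {N F : Type} {rules : Set (FlagRule (Option X) N F)}
    {r' : FlagRule (Option X × Option X) (Mode × N) F} (h : r' ∈ foldFlagRules rules)
    {B : FlagOccurrence (Mode × N) F} (hB : Symbol.nonterminal B ∈ r'.output) :
    ∃ r ∈ rules, ∃ C, Symbol.nonterminal C ∈ r.output ∧ C.inherits = B.inherits := by
  obtain ⟨⟨A, o⟩, x, hx, h⟩ := h
  refine ⟨_, hx, ?_⟩
  have key (m : Mode) (y : List _) (hy : ∀ b ∈ y, b ∈ x)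
      (h : Symbol.nonterminal B ∈ y.map (modeCopy modeOccurrence m)) :
      ∃ C, Symbol.nonterminal C ∈ x ∧ C.inherits = B.inherits := by
    obtain ⟨b, hb, he⟩ := List.mem_map.1 h
    obtain ⟨C, rfl, rfl⟩ := modeCopy_eq_nonterminal he
    exact ⟨C, hy _ hb, rfl⟩
  obtain h | h | ⟨α, b, β, rfl, -, h⟩ := h
  · exact key .left x (fun _ => id) ((Prod.mk.inj h).2 ▸ hB)
  · exact key .right x.reverse (fun _ => List.mem_reverse.1) ((Prod.mk.inj h).2 ▸ hB)
  · rw [(Prod.mk.inj h).2, List.mem_append, List.mem_append] at hB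
    obtain (hB | hB) | hB := hB
    · exact key .left α (by simp +contextual) hB
    · exact key .right β.reverse (by simp +contextual) hB
    · exact key .spine [b] (by simp) hB

theorem IsIndexed.fold {g : FlagGrammar (Option X)} (hg : g.IsIndexed) : g.fold.IsIndexed := by
  intro r' hr' B hB
  obtain ⟨r, hr, C, hC, h⟩ := exists_mem_output_of_mem_foldFlagRules hr' hB
  exact h ▸ hg r hr C hC

end FlagGrammar

theorem U_indexed_subset_T : U Indexed X ⊆ T Indexed X := by
  rintro ρ ⟨g, hg, hρ⟩
  exact ⟨_, ⟨g.fold, hg.fold, rfl⟩, g.tapes_image_language_fold hρ⟩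

theorem U_linearIndexed_subset_T : U LinearIndexed X ⊆ T LinearIndexed X := by
  rintro ρ ⟨g, hg, hρ⟩
  exact ⟨_, ⟨g.fold, hg.fold, rfl⟩, g.tapes_image_language_fold hρ⟩

end Grammars

/-! ### Rational languages -/

section Rational

variable {X : Type u}

/-- The automaton over two tapes that runs `M` forwards on the first tape and backwards on the
second, until the two runs can be joined by reading `#`. -/
def foldDFA {σ : Type} (M : DFA (Option X) σ) : NFA (Option X × Option X) (σ × σ) where
  step s c := {s' | s'.1 = M.evalFrom s.1 (c.1.toList.map some) ∧
    M.evalFrom s'.2 (c.2.toList.map some) = s.2}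
  start := {s | s.1 = M.start ∧ s.2 ∈ M.accept}
  accept := {s | M.step s.1 none = s.2}

/-- The second component moves to a guessed predecessor at each letter, so its path, read in the
direction of `M`, spells the second tape in reverse. -/
theorem mem_evalFrom_foldDFA {σ : Type} (M : DFA (Option X) σ) (s s' : σ × σ)
    (w : List (Option X × Option X)) :
    s' ∈ (foldDFA M).evalFrom {s} w ↔ s'.1 = M.evalFrom s.1 ((tapes w).1.map some) ∧
      M.evalFrom s'.2 ((tapes w).2.reverse.map some) = s.2 := by
  induction w generalizing s with
  | nil => simp [tapes, Prod.ext_iff]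
  | cons c w ih =>
    have hl : (tapes (c :: w)).1 = c.1.toList ++ (tapes w).1 := by
      rcases c with ⟨_ | a, b⟩ <;> rfl
    have hr : (tapes (c :: w)).2 = c.2.toList ++ (tapes w).2 := by
      rcases c with ⟨a, _ | b⟩ <;> rfl
    have hrev : c.2.toList.reverse = c.2.toList := by cases c.2 <;> rfl
    rw [NFA.evalFrom_cons, NFA.stepSet_singleton, NFA.mem_evalFrom_iff_exists]
    simp only [ih, hl, hr, List.reverse_append, hrev, List.map_append, DFA.evalFrom_of_append]
    constructor
    · rintro ⟨t, ⟨h₁, h₂⟩, h₃, h₄⟩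
      exact ⟨by rw [h₃, h₁], by rw [h₄, h₂]⟩
    · rintro ⟨h₁, h₂⟩
      exact ⟨(_, _), ⟨rfl, h₂⟩, h₁, rfl⟩

theorem mem_accepts_foldDFA {σ : Type} (M : DFA (Option X) σ) (w : List (Option X × Option X)) :
    w ∈ (foldDFA M).accepts ↔
      (tapes w).1.map some ++ none :: (tapes w).2.reverse.map some ∈ M.accepts := by
  rw [NFA.mem_accepts, DFA.mem_accepts, DFA.eval, DFA.evalFrom_of_append]
  constructor
  · rintro ⟨s', hs', h⟩
    obtain ⟨s, ⟨hs₁, hs₂⟩, h⟩ := NFA.mem_evalFrom_iff_exists.1 h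
    obtain ⟨h₁, h₂⟩ := (mem_evalFrom_foldDFA ..).1 h
    rw [← hs₁, ← h₁, DFA.evalFrom_cons, hs', h₂]
    exact hs₂
  · intro h
    refine ⟨(M.evalFrom M.start ((tapes w).1.map some), M.step _ none), rfl,
      NFA.mem_evalFrom_iff_exists.2 ⟨(M.start, _), ⟨rfl, h⟩, ?_⟩⟩
    exact (mem_evalFrom_foldDFA ..).2 ⟨rfl, rfl⟩

/-- The folded automaton accepts the full preimage of `ρ`; surjectivity of `tapes` then gives back
`ρ` as the image. -/
theorem exists_tapes_eq (u v : List X) : ∃ w, tapes w = (u, v) :=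
  ⟨u.map (fun x => (some x, none)) ++ v.map (fun x => (none, some x)), by
    simp [tapes, List.filterMap_map]⟩

theorem U_rational_subset_T : U Rational X ⊆ T Rational X := by
  classical
  rintro ρ ⟨σ, _, M, hM⟩
  refine ⟨(foldDFA M).accepts, ⟨Set (σ × σ), Fintype.ofFinite _, (foldDFA M).toDFA,
    NFA.toDFA_correct⟩, ?_⟩
  ext ⟨u, v⟩
  constructor
  · intro h
    obtain ⟨w, hw⟩ := exists_tapes_eq u v
    refine ⟨w, (mem_accepts_foldDFA M w).2 ?_, hw⟩
    rw [hM, hw]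
    exact ⟨u, v, h, rfl⟩
  · rintro ⟨w, hw, hwu⟩
    have := (mem_accepts_foldDFA M w).1 hw
    rw [hM, hwu] at this
    obtain ⟨u', v', h, he⟩ := this
    obtain ⟨hu, hv⟩ := eq_of_append_none_cons_eq he
    have hinj := List.map_injective_iff.2 (Option.some_injective X)
    obtain rfl : u = u' := hinj hu
    obtain rfl : v = v' := List.reverse_injective (hinj hv)
    exact h

end Rational

/-! ### ET0L and EDT0L systems -/

section ET0L

open Relation

variable {X : Type u} {N V₀ : Type}

/-- The non-terminals of the folded ET0L-system: a new start symbol, a symbol from which no word is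
derived, and the copies of the letters in the three modes. -/
inductive FoldNT (V₀ : Type) where
  | start
  | dead
  | copy (m : Mode) (a : V₀)

instance [Finite V₀] : Finite (FoldNT V₀) :=
  Finite.of_surjective (fun c : Option (Option (Mode × V₀)) =>
    c.elim FoldNT.start fun c => c.elim .dead fun c => .copy c.1 c.2) (by
      rintro (_ | _ | ⟨m, a⟩)
      exacts [⟨none, rfl⟩, ⟨some none, rfl⟩, ⟨some (some (m, a)), rfl⟩])

instance {A B : Type*} [Finite A] [Finite B] : Finite (Symbol A B) :=
  Finite.of_surjective (Sum.elim Symbol.terminal Symbol.nonterminal) (by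
    rintro (a | b)
    exacts [⟨.inl a, rfl⟩, ⟨.inr b, rfl⟩])

/-- The copy of a letter of an ET0L-system in a given mode. -/
def letterCopy (e : Symbol (Option X) N ≃ V₀) (m : Mode) (a : Symbol (Option X) N) :
    Symbol (Option X × Option X) (FoldNT V₀) :=
  .nonterminal (.copy m (e a))

/-- The folding of a word around its `k`-th letter. -/
def foldWord (e : Symbol (Option X) N ≃ V₀) (k : ℕ) (x : List (Symbol (Option X) N)) :
    List (Symbol (Option X × Option X) (FoldNT V₀)) :=
  match x.drop k with
  | [] => [.nonterminal .dead]
  | b :: β => (x.take k).map (letterCopy e .left) ++ β.reverse.map (letterCopy e .right) ++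
      [letterCopy e .spine b]

theorem foldWord_append (e : Symbol (Option X) N ≃ V₀) (α β : List (Symbol (Option X) N))
    (b : Symbol (Option X) N) : foldWord e α.length (α ++ b :: β) =
      α.map (letterCopy e .left) ++ β.reverse.map (letterCopy e .right) ++
        [letterCopy e .spine b] := by
  simp [foldWord]

theorem foldWord_eq (e : Symbol (Option X) N ≃ V₀) (k : ℕ) (x : List (Symbol (Option X) N)) :
    foldWord e k x = [.nonterminal .dead] ∨ ∃ α b β, x = α ++ b :: β ∧ foldWord e k x =
      α.map (letterCopy e .left) ++ β.reverse.map (letterCopy e .right) ++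
        [letterCopy e .spine b] := by
  cases hx : x.drop k with
  | nil => exact .inl (by simp [foldWord, hx])
  | cons b β =>
    exact .inr ⟨x.take k, b, β, by rw [← hx, List.take_append_drop], by simp [foldWord, hx]⟩

/-- The productions of the folded table that splits the right-hand side for the spine, or the start
word, at its `k`-th letter. -/
inductive FoldTable (e : Symbol (Option X) N ≃ V₀) (s : List (Symbol (Option X) N))
    (t : Set (Symbol (Option X) N × List (Symbol (Option X) N))) (k : ℕ) :
    Symbol (Option X × Option X) (FoldNT V₀) →
      List (Symbol (Option X × Option X) (FoldNT V₀)) → Prop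
  | terminal (c) : FoldTable e s t k (.terminal c) [.terminal c]
  | dead : FoldTable e s t k (.nonterminal .dead) [.nonterminal .dead]
  | start : FoldTable e s t k (.nonterminal .start) (foldWord e k s)
  | left {a x} (h : (a, x) ∈ t) :
      FoldTable e s t k (letterCopy e .left a) (x.map (letterCopy e .left))
  | right {a x} (h : (a, x) ∈ t) :
      FoldTable e s t k (letterCopy e .right a) (x.reverse.map (letterCopy e .right))
  | spine {a x} (h : (a, x) ∈ t) :
      FoldTable e s t k (letterCopy e .spine a) (foldWord e k x)

/-- The letter that replaces a copy of a letter at the end of a derivation. -/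
def finalCopy : Mode → Symbol (Option X) N → Symbol (Option X × Option X) (FoldNT V₀)
  | .left, .terminal o => .terminal (o, none)
  | .right, .terminal o => .terminal (none, o)
  | .spine, .terminal none => .terminal (none, none)
  | _, _ => .nonterminal .dead

/-- The letter-to-letter table that ends a derivation. -/
def finalLetter (e : Symbol (Option X) N ≃ V₀) :
    Symbol (Option X × Option X) (FoldNT V₀) → Symbol (Option X × Option X) (FoldNT V₀)
  | .terminal c => .terminal c
  | .nonterminal (.copy m a) => finalCopy m (e.symm a)
  | .nonterminal _ => .nonterminal .dead

theorem finalLetter_letterCopy (e : Symbol (Option X) N ≃ V₀) (m : Mode)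
    (a : Symbol (Option X) N) : finalLetter e (letterCopy e m a) = finalCopy m a := by
  simp [finalLetter, letterCopy]

variable {e : Symbol (Option X) N ≃ V₀} {s : List (Symbol (Option X) N)}
  {t : Set (Symbol (Option X) N × List (Symbol (Option X) N))} {k : ℕ}

theorem letterCopy_inj {m m' : Mode} {a a' : Symbol (Option X) N} :
    letterCopy e m a = letterCopy e m' a' ↔ m = m' ∧ a = a' := by
  simp [letterCopy]

theorem FoldTable.of_left {a : Symbol (Option X) N}
    {y : List (Symbol (Option X × Option X) (FoldNT V₀))}
    (h : FoldTable e s t k (letterCopy e .left a) y) :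
    ∃ x, (a, x) ∈ t ∧ y = x.map (letterCopy e .left) := by
  generalize hc : letterCopy e .left a = c at h
  cases h with
  | left h => exact ⟨_, (letterCopy_inj.1 hc).2 ▸ h, rfl⟩
  | right h | spine h => cases (letterCopy_inj.1 hc).1
  | _ => simp [letterCopy] at hc

theorem FoldTable.of_right {a : Symbol (Option X) N}
    {y : List (Symbol (Option X × Option X) (FoldNT V₀))}
    (h : FoldTable e s t k (letterCopy e .right a) y) :
    ∃ x, (a, x) ∈ t ∧ y = x.reverse.map (letterCopy e .right) := by
  generalize hc : letterCopy e .right a = c at h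
  cases h with
  | right h => exact ⟨_, (letterCopy_inj.1 hc).2 ▸ h, rfl⟩
  | left h | spine h => cases (letterCopy_inj.1 hc).1
  | _ => simp [letterCopy] at hc

theorem FoldTable.of_spine {a : Symbol (Option X) N}
    {y : List (Symbol (Option X × Option X) (FoldNT V₀))}
    (h : FoldTable e s t k (letterCopy e .spine a) y) :
    ∃ x, (a, x) ∈ t ∧ y = foldWord e k x := by
  generalize hc : letterCopy e .spine a = c at h
  cases h with
  | spine h => exact ⟨_, (letterCopy_inj.1 hc).2 ▸ h, rfl⟩
  | left h | right h => cases (letterCopy_inj.1 hc).1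
  | _ => simp [letterCopy] at hc

theorem FoldTable.of_start {y : List (Symbol (Option X × Option X) (FoldNT V₀))}
    (h : FoldTable e s t k (.nonterminal .start) y) : y = foldWord e k s := by
  generalize hc : Symbol.nonterminal FoldNT.start = c at h
  cases h with
  | start => rfl
  | _ => simp [letterCopy] at hc

theorem FoldTable.of_dead {y : List (Symbol (Option X × Option X) (FoldNT V₀))}
    (h : FoldTable e s t k (.nonterminal .dead) y) : y = [.nonterminal .dead] := by
  generalize hc : Symbol.nonterminal FoldNT.dead = c at h
  cases h with
  | dead => rfl
  | _ => simp [letterCopy] at hc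

theorem FoldTable.of_terminal {c : Option X × Option X}
    {y : List (Symbol (Option X × Option X) (FoldNT V₀))}
    (h : FoldTable e s t k (.terminal c) y) : y = [.terminal c] := by
  generalize hc : Symbol.terminal c = c' at h
  cases h with
  | terminal =>
    cases hc
    rfl
  | _ => simp [letterCopy] at hc

/-- Parallel steps on the two sides combine into one step on any shuffle. Right copies produce
reversed blocks, hence the `List.reverse` on each member of `y`. -/
theorem Interleaves.exists_foldTable {z : List (Symbol (Option X × Option X) (FoldNT V₀))}
    {p q : List (Symbol (Option X) N)}
    (h : Interleaves (letterCopy e .left) (letterCopy e .right) z p q)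
    {x y : List (List (Symbol (Option X) N))} (hx : List.Forall₂ (fun a x => (a, x) ∈ t) p x)
    (hy : List.Forall₂ (fun a x => (a, x) ∈ t) q y) :
    ∃ zs, List.Forall₂ (FoldTable e s t k) z zs ∧
      Interleaves (letterCopy e .left) (letterCopy e .right) zs.flatten x.flatten
        (y.map List.reverse).flatten := by
  induction h generalizing x y with
  | nil =>
    cases hx; cases hy
    exact ⟨[], .nil, .nil⟩
  | left a _ ih =>
    cases hx with | cons h₁ hx =>
    obtain ⟨zs, h₂, h₃⟩ := ih hx hy
    exact ⟨_ :: zs, .cons (.left h₁) h₂, by simpa using (Interleaves.map_left _).append h₃⟩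
  | right a _ ih =>
    cases hy with | cons h₁ hy =>
    obtain ⟨zs, h₂, h₃⟩ := ih hx hy
    exact ⟨_ :: zs, .cons (.right h₁) h₂, by
      simpa only [List.flatten_cons, List.map_cons, List.nil_append] using
        (Interleaves.map_right _).append h₃⟩

theorem Interleaves.exists_of_foldTable {z : List (Symbol (Option X × Option X) (FoldNT V₀))}
    {p q : List (Symbol (Option X) N)}
    (h : Interleaves (letterCopy e .left) (letterCopy e .right) z p q)
    {zs : List (List (Symbol (Option X × Option X) (FoldNT V₀)))}
    (hz : List.Forall₂ (FoldTable e s t k) z zs) :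
    ∃ x y, List.Forall₂ (fun a x => (a, x) ∈ t) p x ∧ List.Forall₂ (fun a x => (a, x) ∈ t) q y ∧
      Interleaves (letterCopy e .left) (letterCopy e .right) zs.flatten x.flatten
        (y.map List.reverse).flatten := by
  induction h generalizing zs with
  | nil =>
    cases hz
    exact ⟨[], [], .nil, .nil, .nil⟩
  | left a _ ih =>
    cases hz with | cons h₁ hz =>
    obtain ⟨w, hw, rfl⟩ := h₁.of_left
    obtain ⟨x, y, hx, hy, h₃⟩ := ih hz
    exact ⟨w :: x, y, .cons hw hx, hy, by simpa using (Interleaves.map_left _).append h₃⟩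
  | right a _ ih =>
    cases hz with | cons h₁ hz =>
    obtain ⟨w, hw, rfl⟩ := h₁.of_right
    obtain ⟨x, y, hx, hy, h₃⟩ := ih hz
    exact ⟨x, w :: y, hx, .cons hw hy, by
      simpa only [List.flatten_cons, List.map_cons, List.nil_append] using
        (Interleaves.map_right _).append h₃⟩

theorem Interleaves.exists_map_finalLetter
    {z : List (Symbol (Option X × Option X) (FoldNT V₀))} {u v : List X}
    (h : Interleaves (letterCopy e .left) (letterCopy e .right) z
      (u.map (.terminal ∘ some)) (v.map (.terminal ∘ some))) :
    ∃ w, z.map (finalLetter e) = w.map .terminal ∧ tapes w = (u, v) := by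
  generalize hp : u.map (Symbol.terminal (N := N) ∘ some) = p at h
  generalize hq : v.map (Symbol.terminal (N := N) ∘ some) = q at h
  induction h generalizing u v with
  | nil => simp_all [tapes]
  | left a _ ih =>
    obtain ⟨x, u, rfl, rfl, hu⟩ := List.map_eq_cons_iff.1 hp
    obtain ⟨w, hw, ht⟩ := ih hu hq
    exact ⟨(some x, none) :: w, by simp [hw, finalLetter_letterCopy, finalCopy],
      by simp_all [tapes]⟩
  | right a _ ih =>
    obtain ⟨x, v, rfl, rfl, hv⟩ := List.map_eq_cons_iff.1 hq
    obtain ⟨w, hw, ht⟩ := ih hp hv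
    exact ⟨(none, some x) :: w, by simp [hw, finalLetter_letterCopy, finalCopy],
      by simp_all [tapes]⟩

/-- The final table kills copies of non-terminals, so it can succeed only when both sides are
already terminal. -/
theorem Interleaves.dead_mem_or_eq_map_terminal
    {z : List (Symbol (Option X × Option X) (FoldNT V₀))} {p q : List (Symbol (Option X) N)}
    (h : Interleaves (letterCopy e .left) (letterCopy e .right) z p q) :
    .nonterminal .dead ∈ z.map (finalLetter e) ∨
      ∃ p₀ q₀ : List (Option X), p = p₀.map .terminal ∧ q = q₀.map .terminal := by
  induction h with
  | nil => exact .inr ⟨[], [], rfl, rfl⟩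
  | left a _ ih =>
    obtain ih | ⟨p₀, q₀, rfl, rfl⟩ := ih
    · exact .inl (List.mem_cons_of_mem _ ih)
    cases a with
    | terminal o => exact .inr ⟨o :: p₀, q₀, rfl, rfl⟩
    | nonterminal A => exact .inl (by simp [finalLetter_letterCopy, finalCopy])
  | right a _ ih =>
    obtain ih | ⟨p₀, q₀, rfl, rfl⟩ := ih
    · exact .inl (List.mem_cons_of_mem _ ih)
    cases a with
    | terminal o => exact .inr ⟨p₀, o :: q₀, rfl, rfl⟩
    | nonterminal A => exact .inl (by simp [finalLetter_letterCopy, finalCopy])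

theorem flatten_map_reverse_reverse {A : Type*} (xs : List (List A)) :
    (xs.reverse.map List.reverse).flatten = xs.flatten.reverse := by
  simp [List.reverse_flatten]

theorem exists_of_forall₂_append_left {A B : Type*} {R : A → B → Prop} {p q : List A} {w : List B}
    (h : List.Forall₂ R (p ++ q) w) :
    ∃ x y, w = x ++ y ∧ List.Forall₂ R p x ∧ List.Forall₂ R q y := by
  induction p generalizing w with
  | nil => exact ⟨[], w, rfl, .nil, h⟩
  | cons a p ih =>
    cases h with | cons h₁ h =>
    obtain ⟨x, y, rfl, hx, hy⟩ := ih h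
    exact ⟨_ :: x, y, rfl, .cons h₁ hx, hy⟩

theorem exists_of_forall₂_append_cons_right {A B : Type*} {R : A → B → Prop} {w : List A}
    {x y : List B} {b : B} (h : List.Forall₂ R w (x ++ b :: y)) :
    ∃ p a q, w = p ++ a :: q ∧ List.Forall₂ R p x ∧ R a b ∧ List.Forall₂ R q y := by
  obtain ⟨p, q, rfl, hp, hq⟩ := exists_of_forall₂_append_left h.flip
  cases hq with | cons h₁ hq =>
  exact ⟨p, _, _, rfl, hp.flip, h₁, hq.flip⟩

theorem forall₂_eq_singleton {A B : Type*} {f : A → B} {w : List A} {xs : List (List B)}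
    (h : List.Forall₂ (fun a x => x = [f a]) w xs) : xs.flatten = w.map f := by
  induction h with
  | nil => rfl
  | cons h _ ih => simp [h, ih]

theorem forall₂_singleton {A B : Type*} (f : A → B) (w : List A) :
    List.Forall₂ (fun a x => x = [f a]) w (w.map fun a => [f a]) := by
  induction w with
  | nil => exact .nil
  | cons a w ih => exact .cons rfl ih

theorem finite_foldTable [Finite X] (e : Symbol (Option X) N ≃ V₀) (s : List (Symbol (Option X) N))
    (ht : t.Finite) (k : ℕ) :
    {c : _ × _ | FoldTable e s t k c.1 c.2}.Finite := by
  have h₁ := Set.finite_range fun c : Option X × Option X =>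
    ((Symbol.terminal c : Symbol _ (FoldNT V₀)), [(Symbol.terminal c : Symbol _ (FoldNT V₀))])
  have h₂ := ht.image fun c : Symbol (Option X) N × List (Symbol (Option X) N) =>
    (letterCopy e .left c.1, c.2.map (letterCopy e .left))
  have h₃ := ht.image fun c : Symbol (Option X) N × List (Symbol (Option X) N) =>
    (letterCopy e .right c.1, c.2.reverse.map (letterCopy e .right))
  have h₄ := ht.image fun c : Symbol (Option X) N × List (Symbol (Option X) N) =>
    (letterCopy e .spine c.1, foldWord e k c.2)
  refine ((((h₁.insert (.nonterminal .dead, [.nonterminal .dead])).insert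
    (.nonterminal .start, foldWord e k s)).union h₂).union (h₃.union h₄)).subset ?_
  rintro ⟨a, x⟩ (c | _ | _ | h | h | h)
  · exact .inl (.inl (.inr (.inr ⟨c, rfl⟩)))
  · exact .inl (.inl (.inr (.inl rfl)))
  · exact .inl (.inl (.inl rfl))
  · exact .inl (.inr ⟨_, h, rfl⟩)
  · exact .inr (.inl ⟨_, h, rfl⟩)
  · exact .inr (.inr ⟨_, h, rfl⟩)

theorem exists_foldTable (e : Symbol (Option X) N ≃ V₀) (s : List (Symbol (Option X) N))
    (ht : ∀ a, ∃ x, (a, x) ∈ t) (k : ℕ) (a : Symbol (Option X × Option X) (FoldNT V₀)) :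
    ∃ x, FoldTable e s t k a x := by
  obtain c | _ | _ | ⟨m, a⟩ := a
  · exact ⟨_, .terminal c⟩
  · exact ⟨_, .start⟩
  · exact ⟨_, .dead⟩
  · obtain ⟨a, rfl⟩ := e.surjective a
    obtain ⟨x, hx⟩ := ht a
    cases m
    exacts [⟨_, .left hx⟩, ⟨_, .right hx⟩, ⟨_, .spine hx⟩]

theorem existsUnique_foldTable (e : Symbol (Option X) N ≃ V₀) (s : List (Symbol (Option X) N))
    (ht : ∀ a, ∃! x, (a, x) ∈ t) (k : ℕ) (a : Symbol (Option X × Option X) (FoldNT V₀)) :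
    ∃! x, FoldTable e s t k a x := by
  obtain c | _ | _ | ⟨m, a⟩ := a
  · exact ⟨_, .terminal c, fun _ h => h.of_terminal⟩
  · exact ⟨_, .start, fun _ h => h.of_start⟩
  · exact ⟨_, .dead, fun _ h => h.of_dead⟩
  · obtain ⟨a, rfl⟩ := e.surjective a
    obtain ⟨x, hx, hu⟩ := ht a
    cases m
    · refine ⟨_, .left hx, fun y h => ?_⟩
      obtain ⟨x', hx', rfl⟩ := h.of_left
      rw [hu x' hx']
    · refine ⟨_, .right hx, fun y h => ?_⟩
      obtain ⟨x', hx', rfl⟩ := h.of_right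
      rw [hu x' hx']
    · refine ⟨_, .spine hx, fun y h => ?_⟩
      obtain ⟨x', hx', rfl⟩ := h.of_spine
      rw [hu x' hx']

namespace ET0LSystem

/-- The ET0L-system over two tapes for a system that generates words `u # v^rev`. The numbers up to
`K` are used as positions at which words are split. -/
def fold [Finite X] (h : ET0LSystem (Option X)) [Finite V₀] (e : Symbol (Option X) h.NT ≃ V₀)
    (K : ℕ) : ET0LSystem (Option X × Option X) where
  NT := FoldNT V₀
  finite_NT := inferInstance
  start := [.nonterminal .start]
  tables := insert {c | c.2 = [finalLetter e c.1]}
    ((fun d : Set _ × ℕ => {c | FoldTable e h.start d.1 d.2 c.1 c.2}) '' (h.tables ×ˢ Set.Iic K))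
  finite_tables := ((h.finite_tables.prod (Set.finite_Iic K)).image _).insert _
  finite_table := by
    rintro _ (rfl | ⟨d, hd, rfl⟩)
    · exact (Set.finite_range fun a => (a, [finalLetter e a])).subset
        fun c hc => ⟨c.1, Prod.ext rfl (Set.mem_ofPred.1 hc).symm⟩
    · exact finite_foldTable e _ (h.finite_table _ hd.1) _
  total_table := by
    rintro _ (rfl | ⟨d, hd, rfl⟩) a
    · exact ⟨[finalLetter e a], Set.mem_ofPred.2 rfl⟩
    · exact exists_foldTable e _ (h.total_table _ hd.1) _ _

theorem IsDeterministic.fold [Finite X] {h : ET0LSystem (Option X)} [Finite V₀]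
    (hd : h.IsDeterministic) (e : Symbol (Option X) h.NT ≃ V₀) (K : ℕ) :
    (h.fold e K).IsDeterministic := by
  rintro _ (rfl | ⟨d, ht, rfl⟩) a
  · refine ⟨[finalLetter e a], Set.mem_ofPred.2 rfl, fun x hx => ?_⟩
    exact Set.mem_ofPred.1 (show (a, x) ∈ {c : _ × _ | c.2 = [finalLetter e c.1]} from hx)
  · exact existsUnique_foldTable e _ (hd _ ht.1) _ _

/-- The system with an additional table that changes nothing. -/
def addIdentity {A : Type u} [Finite A] (h : ET0LSystem A) : ET0LSystem A where
  NT := h.NT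
  finite_NT := h.finite_NT
  start := h.start
  tables := insert (Set.range fun a => (a, [a])) h.tables
  finite_tables := h.finite_tables.insert _
  finite_table := by
    have := h.finite_NT
    rintro _ (rfl | ht)
    · exact Set.finite_range _
    · exact h.finite_table _ ht
  total_table := by
    rintro _ (rfl | ht) a
    · exact ⟨[a], a, rfl⟩
    · exact h.total_table _ ht a

theorem IsDeterministic.addIdentity {A : Type u} [Finite A] {h : ET0LSystem A}
    (hd : h.IsDeterministic) : h.addIdentity.IsDeterministic := by
  rintro _ (rfl | ht) a
  · refine ⟨[a], ⟨a, rfl⟩, ?_⟩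
    rintro _ ⟨b, hb⟩
    obtain ⟨rfl, rfl⟩ := Prod.mk.inj hb
    rfl
  · exact hd _ ht a

/-- An identity step changes no word. The extra table matters when there are no tables at all: the
folded system needs one in order to split the start word. -/
theorem language_addIdentity {A : Type u} [Finite A] (h : ET0LSystem A) :
    h.addIdentity.language = h.language := by
  have key (w : List (Symbol A h.NT)) : ReflTransGen h.addIdentity.Produces h.start w ↔
      ReflTransGen h.Produces h.start w := by
    constructor <;> intro hw
    · induction hw with
      | refl => exact .refl
      | tail _ h₁ ih =>
        obtain ⟨t, rfl | ht, xs, hxs, rfl⟩ := h₁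
        · refine (congrArg _ ((forall₂_eq_singleton (f := id) (hxs.imp ?_)).trans
            (List.map_id _))).mpr ih
          rintro _ _ ⟨b, hb⟩
          obtain ⟨rfl, rfl⟩ := Prod.mk.inj hb
          rfl
        · exact ih.tail ⟨t, ht, xs, hxs, rfl⟩
    · refine ReflTransGen.mono ?_ _ _ hw
      rintro _ _ ⟨t, ht, xs, hxs, rfl⟩
      exact ⟨t, .inr ht, xs, hxs, rfl⟩
  ext w
  exact key _

theorem exists_length_le {A : Type u} (h : ET0LSystem A) :
    ∃ K, h.start.length ≤ K ∧ ∀ t ∈ h.tables, ∀ c ∈ t, c.2.length ≤ K := by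
  have hf : (⋃ t ∈ h.tables, t).Finite := h.finite_tables.biUnion h.finite_table
  obtain ⟨K, hK⟩ := (hf.image fun c => c.2.length).bddAbove
  exact ⟨max h.start.length K, le_max_left _ _, fun t ht c hc =>
    le_max_of_le_right (hK ⟨c, Set.mem_biUnion ht hc, rfl⟩)⟩

variable [Finite X] [Finite V₀] {h : ET0LSystem (Option X)} {e : Symbol (Option X) h.NT ≃ V₀}
  {K : ℕ}

theorem fold_produces_iff {w w' : List (Symbol (Option X × Option X) (FoldNT V₀))} :
    (h.fold e K).Produces w w' ↔ w' = w.map (finalLetter e) ∨ ∃ t ∈ h.tables, ∃ k ≤ K, ∃ xs,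
      List.Forall₂ (FoldTable e h.start t k) w xs ∧ w' = xs.flatten := by
  constructor
  · rintro ⟨_, rfl | ⟨d, hd, rfl⟩, xs, hxs, rfl⟩
    · exact .inl (forall₂_eq_singleton (hxs.imp fun _ _ h => Set.mem_ofPred.1 h))
    · exact .inr ⟨d.1, hd.1, d.2, hd.2, xs, hxs.imp fun _ _ h => Set.mem_ofPred.1 h, rfl⟩
  · rintro (rfl | ⟨t, ht, k, hk, xs, hxs, rfl⟩)
    · exact ⟨_, .inl rfl, _, (forall₂_singleton (finalLetter e) w).imp
        fun _ _ h => Set.mem_ofPred.2 h, (forall₂_eq_singleton (forall₂_singleton _ w)).symm⟩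
    · exact ⟨_, .inr ⟨(t, k), ⟨ht, hk⟩, rfl⟩, xs, hxs.imp fun _ _ h => Set.mem_ofPred.2 h, rfl⟩

/-- The spine is traced back from `b₀` as for grammars, but now each step rewrites all letters at
once. -/
theorem exists_spine (hK : ∀ t ∈ h.tables, ∀ c ∈ t, c.2.length ≤ K)
    {w₀ p₀ q₀ : List (Symbol (Option X) h.NT)} {b₀ : Symbol (Option X) h.NT}
    (hw : ReflTransGen h.Produces w₀ (p₀ ++ b₀ :: q₀)) :
    ∃ p b q, w₀ = p ++ b :: q ∧
      ∀ z, Interleaves (letterCopy e .left) (letterCopy e .right) z p q.reverse →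
        ∃ z', Interleaves (letterCopy e .left) (letterCopy e .right) z' p₀ q₀.reverse ∧
          ReflTransGen (h.fold e K).Produces (z ++ [letterCopy e .spine b])
            (z' ++ [letterCopy e .spine b₀]) := by
  induction hw using ReflTransGen.head_induction_on with
  | refl => exact ⟨p₀, b₀, q₀, rfl, fun z hz => ⟨z, hz, .refl⟩⟩
  | @head w₁ w₂ h₁ _ ih =>
    obtain ⟨p, b, q, rfl, ih⟩ := ih
    obtain ⟨t, ht, xs, hxs, hw⟩ := h₁
    -- The spine letter `b` lies in one block `α ++ b :: β` of the parallel step. That block comes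
    -- from the previous spine letter, and `α.length` is the split position to be used.
    obtain ⟨xs₁, α, β, xs₂, rfl, rfl, rfl⟩ : ∃ xs₁ α β xs₂, xs = xs₁ ++ (α ++ b :: β) :: xs₂ ∧
        p = xs₁.flatten ++ α ∧ q = β ++ xs₂.flatten := by
      obtain ⟨as, bs, rfl, rfl, h'⟩ | ⟨as, bs, c, cs, ds, rfl, rfl, h'⟩ :=
        List.flatten_eq_append_iff.1 hw.symm
      · obtain ⟨cs, d, ds, rfl, hc, rfl⟩ := List.flatten_eq_cons_iff.1 h'.symm
        exact ⟨as ++ cs, [], d, ds, by simp, by simp [List.flatten_eq_nil_iff.2 hc], rfl⟩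
      · obtain ⟨rfl, rfl⟩ := List.cons.inj h'
        exact ⟨as, bs, cs, ds, rfl, rfl, rfl⟩
    obtain ⟨P, a, Q, rfl, hP, ha, hQ⟩ := exists_of_forall₂_append_cons_right hxs
    refine ⟨P, a, Q, rfl, fun z hz => ?_⟩
    obtain ⟨zs, hzs, hz'⟩ := hz.exists_foldTable (s := h.start) (k := α.length) hP
      (List.rel_reverse hQ)
    obtain ⟨z', hz', hd⟩ := ih (zs.flatten ++ (α.map (letterCopy e .left) ++
      β.reverse.map (letterCopy e .right))) (by
        have := hz'.append (Interleaves.map_left_append_map_right α β.reverse)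
        rwa [flatten_map_reverse_reverse, ← List.reverse_append] at this)
    refine ⟨z', hz', .head (fold_produces_iff.2 (.inr ⟨t, ht, α.length, ?_,
      zs ++ [foldWord e α.length (α ++ b :: β)],
      List.rel_append hzs (.cons (.spine ha) .nil), ?_⟩)) hd⟩
    · refine le_trans ?_ (hK t ht _ ha)
      simp
    · simp [foldWord_append]

/-- The alternatives are: not started, dead, in progress, finished. Dead letters persist, and using
the final table too early creates one, so a terminal word can only be of the last kind. -/
theorem fold_invariant {ρ : Set (List X × List X)} (hρ : h.language = unfoldedLanguage ρ)
    {w : List (Symbol (Option X × Option X) (FoldNT V₀))}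
    (hw : ReflTransGen (h.fold e K).Produces [.nonterminal .start] w) :
    w = [.nonterminal .start] ∨ .nonterminal .dead ∈ w ∨
      (∃ z p b q, w = z ++ [letterCopy e .spine b] ∧
        Interleaves (letterCopy e .left) (letterCopy e .right) z p q.reverse ∧
        ReflTransGen h.Produces h.start (p ++ b :: q)) ∨
      ∃ v, w = v.map .terminal ∧ tapes v ∈ ρ := by
  induction hw with
  | refl => exact .inl rfl
  | tail _ h₁ ih =>
    obtain rfl | ⟨t, ht, k, -, xs, hxs, rfl⟩ := fold_produces_iff.1 h₁
    · obtain rfl | hw | ⟨z, p, b, q, rfl, hz, hd⟩ | ⟨v, rfl, hv⟩ := ih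
      · exact .inr (.inl (by simp [finalLetter]))
      · exact .inr (.inl (List.mem_map.2 ⟨_, hw, rfl⟩))
      · obtain hz' | ⟨p₀, q₀, rfl, hq⟩ := hz.dead_mem_or_eq_map_terminal
        · exact .inr (.inl (by rw [List.map_append]; exact List.mem_append_left _ hz'))
        by_cases hb : b = .terminal none
        · subst hb
          obtain rfl : q = q₀.reverse.map .terminal := by rw [← q.reverse_reverse, hq]; simp
          have hm : p₀ ++ none :: q₀.reverse ∈ h.language := by
            refine Set.mem_ofPred.2 ?_
            simpa using hd
          rw [hρ] at hm
          obtain ⟨u, v, huv, he⟩ := hm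
          obtain ⟨rfl, hq⟩ := eq_of_append_none_cons_eq he
          obtain rfl : q₀ = v.map some := by rw [← q₀.reverse_reverse, hq]; simp
          obtain ⟨y, hy, hyu⟩ := Interleaves.exists_map_finalLetter (u := u) (v := v)
            (by simpa using hz)
          refine .inr (.inr (.inr ⟨y ++ [(none, none)], ?_, ?_⟩))
          · simp [hy, finalLetter_letterCopy, finalCopy]
          · have : tapes (y ++ [(none, none)]) = tapes y := by simp [tapes]
            rwa [this, hyu]
        · refine .inr (.inl ?_)
          rw [List.map_append]
          refine List.mem_append_right _ ?_
          rcases b with (_ | x) | A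
          · exact absurd rfl hb
          · simp [finalLetter_letterCopy, finalCopy]
          · simp [finalLetter_letterCopy, finalCopy]
      · exact .inr (.inr (.inr ⟨v, by simp [finalLetter], hv⟩))
    · obtain rfl | hw | ⟨z, p, b, q, rfl, hz, hd⟩ | ⟨v, rfl, hv⟩ := ih
      · cases hxs with | cons hx hxs =>
        cases hxs
        obtain rfl := hx.of_start
        obtain h' | ⟨α, b, β, hs, h'⟩ := foldWord_eq e k h.start
        · exact .inr (.inl (by simp [h']))
        · refine .inr (.inr (.inl ⟨_, α, b, β, by rw [h', List.flatten_singleton],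
            Interleaves.map_left_append_map_right _ _, ?_⟩))
          rw [← hs]
      · obtain ⟨w₁, w₂, rfl⟩ := List.append_of_mem hw
        obtain ⟨x, y, rfl, -, hy⟩ := exists_of_forall₂_append_left hxs
        cases hy with | cons h₂ _ =>
        obtain rfl := h₂.of_dead
        exact .inr (.inl (by simp))
      · obtain ⟨zs, ys, rfl, hzs, hys⟩ := exists_of_forall₂_append_left hxs
        cases hys with | cons hb hys =>
        cases hys
        obtain ⟨x, hx, rfl⟩ := hb.of_spine
        obtain h' | ⟨α, b', β, rfl, h'⟩ := foldWord_eq e k x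
        · exact .inr (.inl (by simp [h']))
        obtain ⟨xs, ys, hxs, hys, hz'⟩ := hz.exists_of_foldTable hzs
        have hys' := List.rel_reverse hys
        rw [List.reverse_reverse] at hys'
        refine .inr (.inr (.inl ⟨zs.flatten ++ (α.map (letterCopy e .left) ++
          β.reverse.map (letterCopy e .right)), xs.flatten ++ α, b', β ++ ys.reverse.flatten,
          by simp [h'], ?_, hd.tail ⟨t, ht, xs ++ (α ++ b' :: β) :: ys.reverse,
            List.rel_append hxs (.cons hx hys'), by simp⟩⟩))
        have := hz'.append (Interleaves.map_left_append_map_right α β.reverse)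
        rwa [List.reverse_append, ← flatten_map_reverse_reverse, List.reverse_reverse]
      · rw [List.forall₂_map_left_iff] at hxs
        rw [forall₂_eq_singleton (hxs.imp fun _ _ h => h.of_terminal)]
        exact .inr (.inr (.inr ⟨v, rfl, hv⟩))

theorem tapes_image_language_fold {ρ : Set (List X × List X)}
    (hρ : h.language = unfoldedLanguage ρ) (hs : h.start.length ≤ K)
    (hK : ∀ t ∈ h.tables, ∀ c ∈ t, c.2.length ≤ K) (hne : h.tables.Nonempty) :
    ρ = tapes '' ((h.fold e K).language : Set _) := by
  ext ⟨u, v⟩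
  constructor
  · intro huv
    have hm : u.map some ++ none :: v.reverse.map some ∈ h.language := hρ ▸ ⟨u, v, huv, rfl⟩
    have hd : ReflTransGen h.Produces h.start
        (u.map (.terminal ∘ some) ++ .terminal none :: v.reverse.map (.terminal ∘ some)) := by
      simpa using Set.mem_ofPred.1 hm
    obtain ⟨p, b, q, hw, hz⟩ := exists_spine (e := e) hK hd
    obtain ⟨z', hz', hd⟩ := hz _ (Interleaves.map_left_append_map_right p q.reverse)
    obtain ⟨w, hw', hwu⟩ := Interleaves.exists_map_finalLetter (u := u) (v := v)
      (by simpa using hz')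
    obtain ⟨t, ht⟩ := hne
    refine ⟨w ++ [(none, none)], Set.mem_ofPred.2 ?_, by simpa [tapes] using hwu⟩
    have hlast : (h.fold e K).Produces (z' ++ [letterCopy e .spine (.terminal none)])
        ((w ++ [(none, none)]).map .terminal) :=
      fold_produces_iff.2 (.inl (by simp [hw', finalLetter_letterCopy, finalCopy]; rfl))
    -- Any table can split the start word, here at the ancestor of `#`; the simulation follows, and
    -- the final table comes last.
    refine .head (fold_produces_iff.2 (.inr ⟨t, ht, p.length, ?_, [foldWord e p.length h.start],
      .cons .start .nil, rfl⟩)) (.tail ?_ hlast)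
    · refine le_trans ?_ hs
      simp [hw]
    · rw [hw, foldWord_append, List.flatten_singleton]
      exact hd
  · rintro ⟨w, hw, hwu⟩
    obtain h' | h' | ⟨z, p, b, q, h', -⟩ | ⟨y, h', hy⟩ := fold_invariant hρ (Set.mem_ofPred.1 hw)
    · obtain ⟨c, w, rfl, hc, -⟩ := List.map_eq_cons_iff.1 h'
      cases hc
    · obtain ⟨_, -, hc⟩ := List.mem_map.1 h'
      cases hc
    · obtain ⟨w₁, w₂, -, -, hw₂⟩ := List.map_eq_append_iff.1 h'
      obtain ⟨c, w, rfl, hc, -⟩ := List.map_eq_cons_iff.1 hw₂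
      cases hc
    · obtain rfl := List.map_injective_iff.2 (fun _ _ h => Symbol.terminal.inj h) h'
      rwa [← hwu]

/-- A relation whose unfolded language is generated by an ET0L-system is the image of the language of
another one, which may be chosen deterministic if the first one is. -/
theorem exists_tapes_image_eq (h : ET0LSystem (Option X)) {ρ : Set (List X × List X)}
    (hρ : h.language = unfoldedLanguage ρ) : ∃ h' : ET0LSystem (Option X × Option X),
      (h.IsDeterministic → h'.IsDeterministic) ∧ ρ = tapes '' (h'.language : Set _) := by
  have := h.finite_NT
  -- Non-terminals must lie in `Type`, whereas the letters to be copied lie in `Type u`; finiteness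
  -- allows them to be numbered by `Fin n`.
  obtain ⟨n, ⟨e⟩⟩ := Finite.exists_equiv_fin (Symbol (Option X) h.NT)
  obtain ⟨K, hs, hK⟩ := h.addIdentity.exists_length_le
  exact ⟨h.addIdentity.fold e K, fun hd => hd.addIdentity.fold e K,
    tapes_image_language_fold (h.language_addIdentity.trans hρ) hs hK ⟨_, .inl rfl⟩⟩

end ET0LSystem

theorem U_et0l_subset_T [Finite X] : U ET0L X ⊆ T ET0L X := by
  rintro ρ ⟨h, hρ⟩
  obtain ⟨h', -, h''⟩ := h.exists_tapes_image_eq hρ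
  exact ⟨_, ⟨h', rfl⟩, h''⟩

theorem U_edt0l_subset_T [Finite X] : U EDT0L X ⊆ T EDT0L X := by
  rintro ρ ⟨h, hd, hρ⟩
  obtain ⟨h', hd', h''⟩ := h.exists_tapes_image_eq hρ
  exact ⟨_, ⟨h', hd' hd, rfl⟩, h''⟩

end ET0L

end WordRel

theorem proposition4p3 {X : Type u} [Finite X] :
    WordRel.U WordRel.Indexed X ⊆ WordRel.T WordRel.Indexed X ∧
    WordRel.U WordRel.LinearIndexed X ⊆ WordRel.T WordRel.LinearIndexed X ∧
    WordRel.U WordRel.ET0L X ⊆ WordRel.T WordRel.ET0L X ∧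
    WordRel.U WordRel.EDT0L X ⊆ WordRel.T WordRel.EDT0L X ∧
    WordRel.U WordRel.ContextFree X ⊆ WordRel.T WordRel.ContextFree X ∧
    WordRel.U WordRel.Rational X ⊆ WordRel.T WordRel.Rational X := by
  exact ⟨WordRel.U_indexed_subset_T, WordRel.U_linearIndexed_subset_T, WordRel.U_et0l_subset_T,
    WordRel.U_edt0l_subset_T, WordRel.U_contextFree_subset_T, WordRel.U_rational_subset_T⟩
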